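/- Let $q$ be an indeterminate and $R_3=\mathbb{Z}[q^{\pm1},(q+1)^{-1},\tfrac12]$. For $n\ge 2$ let $\mathscr{H}=\mathscr{H}_{R_3,B_n}(1,q)$ be the Iwahori–Hecke algebra of type $B_n$ with parameters $1,q$, that is, the $R_3$-algebra with generators $a_1,\dots,a_n$ and defining relations $a_1^2=1$; $a_i^2=(q-1)a_i+q$ for $2\le i\le n$; $a_1a_2a_1a_2=a_2a_1a_2a_1$; $a_ia_{i+1}a_i=a_{i+1}a_ia_{i+1}$ for $2\le i\le n-1$; $a_ia_j=a_ja_i$ for $|i-j|>1$. Let $\sharp,\natural,\flat$ be the involutive $R_3$-algebra automorphisms of $\mathscr{H}$ given by $$a_1^\sharp=-a_1,\ a_i^\sharp=a_i;\qquad a_1^\natural=-a_1,\ a_i^\natural=(q-1)-a_i;\qquad a_1^\flat=a_1,\ a_i^\flat=(q-1)-a_i\qquad(i\ge2),$$ and let $\mathscr{H}^\sharp,\mathscr{H}^\natural,\mathscr{H}^\flat$ be their subalgebras of fixed elements. Put $b_1=\tfrac12(a_1-a_1^\natural)$ and $b_i=(a_i-a_i^\natural)/(q+1)$ for $i\ge2$,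 and $\bar b_1=b_1b_2b_1$, $\bar b_i=b_i$ for $i\ge 2$. Let $\mathscr{H}^\dagger$ be the $R_3$-subalgebra of $\mathscr{H}$ generated by all products of an even number of factors from $\bar b_1,\dots,\bar b_n$. Then $\mathscr{H}^\dagger=\mathscr{H}^\natural\cap\mathscr{H}^\flat\cap\mathscr{H}^\sharp$, and $\mathscr{H}^\dagger$ is a free $R_3$-module of rank $2^{n-2}\,n!$. -/

import Mathlib

open scoped Nat Polynomial

namespace HeckeTypeB

noncomputable section

/-- The ring `ℤ[q^{±1}, (q+1)⁻¹, 1/2]`, with `q` an indeterminate. -/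
abbrev R₃ : Type := Localization.Away (2 * Polynomial.X * (Polynomial.X + 1) : ℤ[X])

/-- The indeterminate `q`, as an element of `R₃`. -/
def q : R₃ := algebraMap ℤ[X] R₃ Polynomial.X

theorem isUnit_prod : IsUnit ((2 : R₃) * q * (q + 1)) := by
  have h := IsLocalization.Away.algebraMap_isUnit (S := R₃)
    (2 * Polynomial.X * (Polynomial.X + 1) : ℤ[X])
  rwa [map_mul, map_mul, map_add, map_one, map_ofNat] at h

theorem isUnit_two : IsUnit (2 : R₃) :=
  isUnit_of_mul_isUnit_left (isUnit_of_mul_isUnit_left isUnit_prod)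

theorem isUnit_q : IsUnit q :=
  isUnit_of_mul_isUnit_right (isUnit_of_mul_isUnit_left isUnit_prod)

theorem isUnit_q_add_one : IsUnit (q + 1) :=
  isUnit_of_mul_isUnit_right isUnit_prod

/-- The defining relations of the Hecke algebra of type `B_n` with parameters `u`, `v`.
The generator `a_{i+1}` of the usual numbering `a_1, …, a_n` is indexed by `i : Fin n`. -/
inductive Rel (R : Type) [CommRing R] (u v : R) (n : ℕ) :
    FreeAlgebra R (Fin n) → FreeAlgebra R (Fin n) → Prop
  | sq_first (i : Fin n) (hi : (i : ℕ) = 0) :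
      Rel R u v n (FreeAlgebra.ι R i * FreeAlgebra.ι R i)
        ((u - 1) • FreeAlgebra.ι R i + algebraMap R _ u)
  | sq_other (i : Fin n) (hi : (i : ℕ) ≠ 0) :
      Rel R u v n (FreeAlgebra.ι R i * FreeAlgebra.ι R i)
        ((v - 1) • FreeAlgebra.ι R i + algebraMap R _ v)
  | braid_four (i j : Fin n) (hi : (i : ℕ) = 0) (hj : (j : ℕ) = 1) :
      Rel R u v n
        (FreeAlgebra.ι R i * FreeAlgebra.ι R j * FreeAlgebra.ι R i * FreeAlgebra.ι R j)
        (FreeAlgebra.ι R j * FreeAlgebra.ι R i * FreeAlgebra.ι R j * FreeAlgebra.ι R i)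
  | braid_three (i j : Fin n) (hi : (i : ℕ) ≠ 0) (hj : (j : ℕ) = (i : ℕ) + 1) :
      Rel R u v n
        (FreeAlgebra.ι R i * FreeAlgebra.ι R j * FreeAlgebra.ι R i)
        (FreeAlgebra.ι R j * FreeAlgebra.ι R i * FreeAlgebra.ι R j)
  | comm (i j : Fin n) (hij : (i : ℕ) + 1 < (j : ℕ)) :
      Rel R u v n (FreeAlgebra.ι R i * FreeAlgebra.ι R j)
        (FreeAlgebra.ι R j * FreeAlgebra.ι R i)

/-- The Hecke algebra of type `B_n` over `R` with parameters `u`, `v`. -/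
def HeckeB (R : Type) [CommRing R] (u v : R) (n : ℕ) : Type := RingQuot (Rel R u v n)

instance (R : Type) [CommRing R] (u v : R) (n : ℕ) : Ring (HeckeB R u v n) :=
  inferInstanceAs (Ring (RingQuot (Rel R u v n)))

instance (R : Type) [CommRing R] (u v : R) (n : ℕ) : Algebra R (HeckeB R u v n) :=
  inferInstanceAs (Algebra R (RingQuot (Rel R u v n)))

/-- The quotient map from the free algebra. -/
def mk (R : Type) [CommRing R] (u v : R) (n : ℕ) :
    FreeAlgebra R (Fin n) →ₐ[R] HeckeB R u v n :=
  RingQuot.mkAlgHom R (Rel R u v n)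

theorem mk_rel {R : Type} [CommRing R] {u v : R} {n : ℕ} {x y : FreeAlgebra R (Fin n)}
    (h : Rel R u v n x y) : mk R u v n x = mk R u v n y :=
  RingQuot.mkAlgHom_rel R h

/-- The Hecke algebra of type `B_n` over `R₃` with parameters `1` and `q`. -/
abbrev H (n : ℕ) : Type := HeckeB R₃ 1 q n

/-- The standard generators of `H n`; `a i` is the generator usually numbered `i + 1`. -/
def a {n : ℕ} (i : Fin n) : H n := mk R₃ 1 q n (FreeAlgebra.ι R₃ i)

variable {n : ℕ}

theorem a_sq_first (i : Fin n) (hi : (i : ℕ) = 0) : a i * a i = (1 : H n) := by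
  simpa [a] using mk_rel (Rel.sq_first (R := R₃) (u := 1) (v := q) i hi)

theorem a_sq_other (i : Fin n) (hi : (i : ℕ) ≠ 0) :
    a i * a i = (q - 1) • a i + algebraMap R₃ (H n) q := by
  simpa only [a, map_mul, map_add, map_smul, AlgHom.commutes] using
    mk_rel (Rel.sq_other (R := R₃) (u := 1) (v := q) i hi)

theorem a_braid_four (i j : Fin n) (hi : (i : ℕ) = 0) (hj : (j : ℕ) = 1) :
    a i * a j * a i * a j = a j * a i * a j * a i := by
  simpa [a] using mk_rel (Rel.braid_four (R := R₃) (u := 1) (v := q) i j hi hj)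

theorem a_braid_three (i j : Fin n) (hi : (i : ℕ) ≠ 0) (hj : (j : ℕ) = (i : ℕ) + 1) :
    a i * a j * a i = a j * a i * a j := by
  simpa [a] using mk_rel (Rel.braid_three (R := R₃) (u := 1) (v := q) i j hi hj)

theorem a_comm (i j : Fin n) (hij : (i : ℕ) + 1 < (j : ℕ)) : a i * a j = a j * a i := by
  simpa [a] using mk_rel (Rel.comm (R := R₃) (u := 1) (v := q) i j hij)

/-- The homomorphism with prescribed images of the generators, once these satisfy the
defining relations. -/
def lift {R : Type} [CommRing R] {u v : R} {A : Type*} [Ring A] [Algebra R A] (f : Fin n → A)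
    (h : ∀ ⦃x y⦄, Rel R u v n x y → FreeAlgebra.lift R f x = FreeAlgebra.lift R f y) :
    HeckeB R u v n →ₐ[R] A :=
  RingQuot.liftAlgHom R ⟨FreeAlgebra.lift R f, h⟩

theorem lift_mk {R : Type} [CommRing R] {u v : R} {A : Type*} [Ring A] [Algebra R A]
    (f : Fin n → A) (h) (x : FreeAlgebra R (Fin n)) :
    lift (u := u) (v := v) f h (mk R u v n x) = FreeAlgebra.lift R f x :=
  RingQuot.liftAlgHom_mkAlgHom_apply _ _ h x

theorem lift_a {A : Type*} [Ring A] [Algebra R₃ A] (f : Fin n → A) (h) (i : Fin n) :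
    lift f h (a i) = f i := by
  rw [a, lift_mk, FreeAlgebra.lift_ι_apply]

theorem reflect_sq {R A : Type*} [CommRing R] [Ring A] [Algebra R A] {t : R} {x : A}
    (hx : x * x = (t - 1) • x + algebraMap R A t) :
    (algebraMap R A (t - 1) - x) * (algebraMap R A (t - 1) - x) =
      (t - 1) • (algebraMap R A (t - 1) - x) + algebraMap R A t := by
  simp only [Algebra.algebraMap_eq_smul_one, sub_mul, mul_sub, smul_mul_assoc,
    mul_smul_comm, one_mul, mul_one, smul_sub] at *
  rw [hx]
  module

theorem reflect_braid_three {R A : Type*} [CommRing R] [Ring A] [Algebra R A] {t : R} {x y : A}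
    (hx : x * x = (t - 1) • x + algebraMap R A t) (hy : y * y = (t - 1) • y + algebraMap R A t)
    (h : x * y * x = y * x * y) :
    (algebraMap R A (t - 1) - x) * (algebraMap R A (t - 1) - y) * (algebraMap R A (t - 1) - x) =
      (algebraMap R A (t - 1) - y) * (algebraMap R A (t - 1) - x) *
        (algebraMap R A (t - 1) - y) := by
  simp only [Algebra.algebraMap_eq_smul_one, sub_mul, mul_sub, smul_mul_assoc,
    mul_smul_comm, one_mul, mul_one, smul_sub] at *
  rw [hx, hy, h]
  module

theorem reflect_comm {R A : Type*} [CommRing R] [Ring A] [Algebra R A] {c : R} {x y : A}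
    (h : x * y = y * x) :
    (algebraMap R A c - x) * (algebraMap R A c - y) =
      (algebraMap R A c - y) * (algebraMap R A c - x) := by
  simp only [Algebra.algebraMap_eq_smul_one, sub_mul, mul_sub, smul_mul_assoc,
    mul_smul_comm, one_mul, mul_one, smul_sub]
  rw [h]
  module

theorem reflect_braid_four {R A : Type*} [CommRing R] [Ring A] [Algebra R A] {c : R} {x y : A}
    (hx : x * x = 1) (h : x * y * x * y = y * x * y * x) :
    x * (algebraMap R A c - y) * x * (algebraMap R A c - y) =
      (algebraMap R A c - y) * x * (algebraMap R A c - y) * x := by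
  have h' : y * x * x = y := by rw [mul_assoc, hx, mul_one]
  simp only [Algebra.algebraMap_eq_smul_one, sub_mul, mul_sub, smul_mul_assoc,
    mul_smul_comm, one_mul, mul_one, smul_sub]
  simp only [hx, h, h', one_mul]
  module

/-- `(q - 1) - a_i`. -/
def dual (i : Fin n) : H n := algebraMap R₃ (H n) (q - 1) - a i

theorem dual_sq (i : Fin n) (hi : (i : ℕ) ≠ 0) :
    dual i * dual i = (q - 1) • dual i + algebraMap R₃ (H n) q :=
  reflect_sq (a_sq_other i hi)

theorem dual_braid_three (i j : Fin n) (hi : (i : ℕ) ≠ 0) (hj : (j : ℕ) = (i : ℕ) + 1) :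
    dual i * dual j * dual i = dual j * dual i * dual j :=
  reflect_braid_three (a_sq_other i hi) (a_sq_other j (by omega)) (a_braid_three i j hi hj)

theorem dual_comm (i j : Fin n) (hij : (i : ℕ) + 1 < (j : ℕ)) :
    dual i * dual j = dual j * dual i :=
  reflect_comm (a_comm i j hij)

theorem dual_braid_four (i j : Fin n) (hi : (i : ℕ) = 0) (hj : (j : ℕ) = 1) :
    a i * dual j * a i * dual j = dual j * a i * dual j * a i :=
  reflect_braid_four (a_sq_first i hi) (a_braid_four i j hi hj)

theorem a_dual_comm (i j : Fin n) (hij : (i : ℕ) + 1 < (j : ℕ)) :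
    a i * dual j = dual j * a i := by
  have h := a_comm i j hij
  simp [dual, sub_mul, mul_sub, h, Algebra.commutes]

/-- Images of the generators under `♯`: `a_1 ↦ -a_1`, and `a_i ↦ a_i` for `i ≥ 2`. -/
def sharpGen (i : Fin n) : H n := if (i : ℕ) = 0 then -a i else a i

/-- Images of the generators under `♮`: `a_1 ↦ -a_1`, and `a_i ↦ (q - 1) - a_i` for `i ≥ 2`. -/
def naturalGen (i : Fin n) : H n := if (i : ℕ) = 0 then -a i else dual i

/-- Images of the generators under `♭`: `a_1 ↦ a_1`, and `a_i ↦ (q - 1) - a_i` for `i ≥ 2`. -/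
def flatGen (i : Fin n) : H n := if (i : ℕ) = 0 then a i else dual i

/-- The involution `♯` of `H n`. -/
def sharp : H n →ₐ[R₃] H n :=
  lift sharpGen (by
    intro x y hxy
    cases hxy with
    | sq_first i hi => simp [sharpGen, hi, a_sq_first]
    | sq_other i hi => simp [sharpGen, hi, a_sq_other]
    | braid_four i j hi hj => simp [sharpGen, hi, hj, a_braid_four i j hi hj]
    | braid_three i j hi hj => simp [sharpGen, hi, hj, a_braid_three i j hi hj]
    | comm i j hij =>
      have hj : (j : ℕ) ≠ 0 := by omega
      by_cases hi : (i : ℕ) = 0 <;> simp [sharpGen, hi, hj, a_comm i j hij])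

/-- The Goldman involution `♮` of `H n`. -/
def natural : H n →ₐ[R₃] H n :=
  lift naturalGen (by
    intro x y hxy
    cases hxy with
    | sq_first i hi => simp [naturalGen, hi, a_sq_first]
    | sq_other i hi => simpa [naturalGen, hi] using dual_sq i hi
    | braid_four i j hi hj => simp [naturalGen, hi, hj, dual_braid_four i j hi hj]
    | braid_three i j hi hj => simp [naturalGen, hi, hj, dual_braid_three i j hi hj]
    | comm i j hij =>
      have hj : (j : ℕ) ≠ 0 := by omega
      by_cases hi : (i : ℕ) = 0 <;>
        simp [naturalGen, hi, hj, dual_comm i j hij, a_dual_comm i j hij])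

/-- The involution `♭` of `H n`. -/
def flat : H n →ₐ[R₃] H n :=
  lift flatGen (by
    intro x y hxy
    cases hxy with
    | sq_first i hi => simp [flatGen, hi, a_sq_first]
    | sq_other i hi => simpa [flatGen, hi] using dual_sq i hi
    | braid_four i j hi hj => simp [flatGen, hi, hj, dual_braid_four i j hi hj]
    | braid_three i j hi hj => simp [flatGen, hi, hj, dual_braid_three i j hi hj]
    | comm i j hij =>
      have hj : (j : ℕ) ≠ 0 := by omega
      by_cases hi : (i : ℕ) = 0 <;>
        simp [flatGen, hi, hj, dual_comm i j hij, a_dual_comm i j hij])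

/-- The subalgebra of elements fixed by an endomorphism. -/
def fixed (f : H n →ₐ[R₃] H n) : Subalgebra R₃ (H n) := AlgHom.equalizer f (AlgHom.id R₃ (H n))

theorem mem_fixed (f : H n →ₐ[R₃] H n) (h : H n) : h ∈ fixed f ↔ f h = h := Iff.rfl

/-- `b_1 = (a_1 - a_1^♮) / 2`, and `b_i = (a_i - a_i^♮) / (q + 1)` for `i ≥ 2`. Both
denominators are units of `R₃`, by `isUnit_two` and `isUnit_q_add_one`. -/
def b (i : Fin n) : H n :=
  Ring.inverse (if (i : ℕ) = 0 then (2 : R₃) else q + 1) • (a i - natural (a i))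

/-- `b̄_1 = b_1 b_2 b_1`, and `b̄_i = b_i` for `i ≥ 2`. -/
def bBar (hn : 2 ≤ n) (i : Fin n) : H n :=
  if (i : ℕ) = 0 then b i * b ⟨1, hn⟩ * b i else b i

/-- The subalgebra `H(n)^†`, generated by all products of an even number of factors taken from
`b̄_1, …, b̄_n`. -/
def dagger (hn : 2 ≤ n) : Subalgebra R₃ (H n) :=
  Algebra.adjoin R₃ {x | ∃ l : List (Fin n), Even l.length ∧ x = (l.map (bBar hn)).prod}

end

end HeckeTypeB

namespace HeckeTypeB

noncomputable section

variable {n : ℕ}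

/-! Index the generators from `0`. The `b i` are involutions generating `H n`; they satisfy the type
B relations, except that the braid relation of length three acquires a correction `c • (b j - b i)`.
The automorphism `sharp` negates `b 0` and fixes the other `b i`, `flat` does the reverse, and
`natural` is their composite. Hence every word in the `b i` is a common eigenvector, with signs
given by the parities of its number of letters `b 0` and of its number of other letters.

The words in normal form, built from prefixes of `b_m ⋯ b_0 ⋯ b_m`, are a basis. They span because
the correction only produces shorter terms (`cosetRep_mul_gen_mem`). They are independent because
`regularRep` maps `H n` onto a free module whose rank is their number (`regularRep_one_surjective`).
As `2` is a unit, an element fixed by `sharp` and `flat` involves only basis words of trivial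
bidegree. Conversely, moving every `b 0` in such a word to the right turns it into an even product
of `bBar`s (`IsWord.mem_dagger`).

The rank is therefore the number of normal forms of trivial bidegree, a quarter of `2 ^ n * n !`
(`card_degree_eq`). -/

/-! ### The normalised generators `b i` and the three involutions -/

theorem reflect_sub_sq {R A : Type*} [CommRing R] [Ring A] [Algebra R A] {t u : R} {x : A}
    (hx : x * x = (t - 1) • x + algebraMap R A t) (hu : u * (t + 1) = 1) :
    (u • (x - (algebraMap R A (t - 1) - x))) * (u • (x - (algebraMap R A (t - 1) - x))) = 1 := by
  -- The square of `2x - (t - 1)` is the discriminant `(t - 1)² + 4t = (t + 1)²`.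
  have h : (1 : A) = (u * (t + 1)) ^ 2 • (1 : A) := by rw [hu]; simp
  rw [h]
  simp only [Algebra.algebraMap_eq_smul_one, sub_mul, mul_sub, smul_mul_assoc,
    mul_smul_comm, one_mul, mul_one, smul_sub] at *
  rw [hx]
  module

/-- The cubic terms cancel by the braid relation and the squares reduce to linear terms, so the
defect is linear in the two generators. -/
theorem reflect_sub_braid_three {R A : Type*} [CommRing R] [Ring A] [Algebra R A] {t u : R}
    {x y : A} (hx : x * x = (t - 1) • x + algebraMap R A t)
    (hy : y * y = (t - 1) • y + algebraMap R A t) (h : x * y * x = y * x * y) :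
    (u • (x - (algebraMap R A (t - 1) - x))) * (u • (y - (algebraMap R A (t - 1) - y))) *
      (u • (x - (algebraMap R A (t - 1) - x))) =
    (u • (y - (algebraMap R A (t - 1) - y))) * (u • (x - (algebraMap R A (t - 1) - x))) *
      (u • (y - (algebraMap R A (t - 1) - y))) +
      ((t - 1) * u) ^ 2 • ((u • (y - (algebraMap R A (t - 1) - y))) -
        (u • (x - (algebraMap R A (t - 1) - x)))) := by
  simp only [Algebra.algebraMap_eq_smul_one, sub_mul, mul_sub, smul_mul_assoc,
    mul_smul_comm, one_mul, mul_one, smul_sub] at *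
  rw [hx, hy, h]
  module

theorem reflect_sub_braid_four {R A : Type*} [CommRing R] [Ring A] [Algebra R A] {t u : R}
    {x y : A} (hx : x * x = 1) (h : x * y * x * y = y * x * y * x) :
    x * (u • (y - (algebraMap R A (t - 1) - y))) * x * (u • (y - (algebraMap R A (t - 1) - y))) =
    (u • (y - (algebraMap R A (t - 1) - y))) * x * (u • (y - (algebraMap R A (t - 1) - y))) *
      x := by
  have h' : y * x * x = y := by rw [mul_assoc, hx, mul_one]
  simp only [Algebra.algebraMap_eq_smul_one, sub_mul, mul_sub, smul_mul_assoc,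
    mul_smul_comm, one_mul, mul_one, smul_sub]
  simp only [hx, h, h', one_mul]
  module

theorem natural_a (i : Fin n) : natural (a i) = naturalGen i := lift_a _ _ i
theorem sharp_a (i : Fin n) : sharp (a i) = sharpGen i := lift_a _ _ i
theorem flat_a (i : Fin n) : flat (a i) = flatGen i := lift_a _ _ i

theorem b_first (i : Fin n) (hi : (i : ℕ) = 0) : b i = a i := by
  have h : a i + a i = (2 : R₃) • a i := by rw [two_smul]
  simp only [b, hi, natural_a, naturalGen, if_true, sub_neg_eq_add]
  rw [h, smul_smul, Ring.inverse_mul_cancel _ isUnit_two, one_smul]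

theorem b_other (i : Fin n) (hi : (i : ℕ) ≠ 0) :
    b i = Ring.inverse (q + 1) • (a i - (algebraMap R₃ (H n) (q - 1) - a i)) := by
  simp only [b, hi, natural_a, naturalGen, if_false, dual]

theorem b_sq (i : Fin n) : b i * b i = 1 := by
  by_cases hi : (i : ℕ) = 0
  · rw [b_first i hi, a_sq_first i hi]
  · rw [b_other i hi]
    exact reflect_sub_sq (a_sq_other i hi) (Ring.inverse_mul_cancel _ isUnit_q_add_one)

theorem b_comm (i j : Fin n) (hij : (i : ℕ) + 1 < (j : ℕ)) : b i * b j = b j * b i := by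
  have key : Commute (a i) (a j) := a_comm i j hij
  have hj : (j : ℕ) ≠ 0 := by omega
  have comm' : ∀ (x : H n), Commute x (a j) → Commute x (b j) := fun x hx => by
    rw [b_other j hj]
    exact (hx.sub_right ((Algebra.commute_algebraMap_right _ _).sub_right hx)).smul_right _
  by_cases hi : (i : ℕ) = 0
  · rw [b_first i hi]; exact comm' _ key
  · apply comm'
    rw [b_other i hi]
    exact (key.sub_left ((Algebra.commute_algebraMap_left _ _).sub_left key)).smul_left _

theorem b_braid_four (i j : Fin n) (hi : (i : ℕ) = 0) (hj : (j : ℕ) = 1) :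
    b i * b j * b i * b j = b j * b i * b j * b i := by
  rw [b_first i hi, b_other j (by omega)]
  exact reflect_sub_braid_four (a_sq_first i hi) (a_braid_four i j hi hj)

theorem b_braid_three (i j : Fin n) (hi : (i : ℕ) ≠ 0) (hj : (j : ℕ) = (i : ℕ) + 1) :
    b i * b j * b i = b j * b i * b j +
      ((q - 1) * Ring.inverse (q + 1)) ^ 2 • (b j - b i) := by
  rw [b_other i hi, b_other j (by omega)]
  exact reflect_sub_braid_three (a_sq_other i hi) (a_sq_other j (by omega))
    (a_braid_three i j hi hj)

theorem sharp_b (i : Fin n) : sharp (b i) = if (i : ℕ) = 0 then -b i else b i := by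
  by_cases hi : (i : ℕ) = 0
  · simp [b_first i hi, sharp_a, sharpGen, hi]
  · rw [b_other i hi, map_smul]
    simp only [map_sub, AlgHom.commutes, sharp_a, sharpGen, hi, if_false]

theorem flat_b (i : Fin n) : flat (b i) = if (i : ℕ) = 0 then b i else -b i := by
  by_cases hi : (i : ℕ) = 0
  · simp [b_first i hi, flat_a, flatGen, hi]
  · rw [b_other i hi, map_smul]
    simp only [map_sub, AlgHom.commutes, flat_a, flatGen, hi, if_false, dual]
    rw [← smul_neg]
    congr 1
    abel

theorem adjoin_range_a : Algebra.adjoin R₃ (Set.range (a : Fin n → H n)) = ⊤ := by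
  have h : Set.range (a : Fin n → H n) = mk R₃ 1 q n '' Set.range (FreeAlgebra.ι R₃) := by
    rw [← Set.range_comp]; rfl
  rw [h, ← AlgHom.map_adjoin, FreeAlgebra.adjoin_range_ι, Algebra.map_top,
    AlgHom.range_eq_top]
  exact RingQuot.mkAlgHom_surjective R₃ _

theorem adjoin_range_b : Algebra.adjoin R₃ (Set.range (b : Fin n → H n)) = ⊤ := by
  rw [eq_top_iff, ← adjoin_range_a]
  refine Algebra.adjoin_le ?_
  rintro _ ⟨i, rfl⟩
  have hb : b i ∈ Algebra.adjoin R₃ (Set.range (b : Fin n → H n)) :=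
    Algebra.subset_adjoin ⟨i, rfl⟩
  by_cases hi : (i : ℕ) = 0
  · rwa [b_first i hi] at hb
  -- This inverts `(q + 1) b_i = 2 a_i - (q - 1)`, using that `2` is a unit.
  · have h : a i = Ring.inverse (2 : R₃) • ((q + 1) • b i + algebraMap R₃ (H n) (q - 1)) := by
      rw [b_other i hi, smul_smul, Ring.mul_inverse_cancel _ isUnit_q_add_one, one_smul,
        show a i - (algebraMap R₃ (H n) (q - 1) - a i) + algebraMap R₃ (H n) (q - 1) =
          (2 : R₃) • a i by rw [two_smul]; abel, smul_smul, Ring.inverse_mul_cancel _ isUnit_two,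
        one_smul]
    rw [h]
    exact Subalgebra.smul_mem _ (add_mem (Subalgebra.smul_mem _ hb _)
      (Subalgebra.algebraMap_mem _ _)) _

theorem natural_eq_sharp_flat (x : H n) : natural x = sharp (flat x) := by
  have h : Set.EqOn (natural : H n →ₐ[R₃] H n) (sharp.comp flat) (Set.range a) := by
    rintro _ ⟨i, rfl⟩
    by_cases hi : (i : ℕ) = 0
    · simp [natural_a, naturalGen, flat_a, flatGen, sharp_a, sharpGen, hi]
    · simp only [AlgHom.comp_apply, natural_a, naturalGen, flat_a, flatGen, hi, if_false, dual,
        map_sub, AlgHom.commutes, sharp_a, sharpGen]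
  exact DFunLike.congr_fun (AlgHom.ext_of_adjoin_eq_top adjoin_range_a h) x

/-! ### Normal forms span: rewriting along the chain of parabolic subalgebras -/

/-- The index of the `j`-th letter of the longest minimal coset representative
`b_m ⋯ b_1 b_0 b_1 ⋯ b_m`. -/
def letter (m j : ℕ) : ℕ := (m - j) + (j - m)

section Spanning

variable {R B : Type*} [CommRing R] [Ring B] [Algebra R B]

/-- The product of the first `j` letters of `b_m ⋯ b_1 b_0 b_1 ⋯ b_m`. -/
def cosetRep {M : Type*} [Monoid M] (b : ℕ → M) (m : ℕ) : ℕ → M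
  | 0 => 1
  | j + 1 => cosetRep b m j * b (letter m j)

/-- The parabolic subalgebra generated by `b_0, …, b_{m-1}`. -/
def parabolic (R : Type*) {B : Type*} [CommRing R] [Ring B] [Algebra R B] (b : ℕ → B) (m : ℕ) :
    Subalgebra R B :=
  Algebra.adjoin R (b '' Set.Iio m)

/-- The sum of the left translates of the coset representatives of length at most `j`. -/
def cosetSpan (R : Type*) {B : Type*} [CommRing R] [Ring B] [Algebra R B] (b : ℕ → B) (m j : ℕ) :
    Submodule R B :=
  Submodule.span R {z | ∃ x ∈ parabolic R b m, ∃ k ≤ j, z = x * cosetRep b m k}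

variable {b : ℕ → B} {m : ℕ} {c : R}

theorem mul_mem_cosetSpan {j : ℕ} {x y : B} (hx : x ∈ parabolic R b m)
    (hy : y ∈ cosetSpan R b m j) : x * y ∈ cosetSpan R b m j := by
  induction hy using Submodule.span_induction with
  | mem y hy =>
    obtain ⟨z, hz, k, hk, rfl⟩ := hy
    exact Submodule.subset_span ⟨x * z, mul_mem hx hz, k, hk, (mul_assoc _ _ _).symm⟩
  | zero => simp
  | add y z _ _ hy hz => rw [mul_add]; exact add_mem hy hz
  | smul r y _ hy => rw [mul_smul_comm]; exact Submodule.smul_mem _ _ hy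

theorem cosetRep_mem_cosetSpan {k j : ℕ} (hk : k ≤ j) : cosetRep b m k ∈ cosetSpan R b m j :=
  Submodule.subset_span ⟨1, one_mem _, k, hk, (one_mul _).symm⟩

theorem cosetSpan_mono {k j : ℕ} (hk : k ≤ j) : cosetSpan R b m k ≤ cosetSpan R b m j :=
  Submodule.span_mono fun _ ⟨x, hx, i, hi, h⟩ => ⟨x, hx, i, hi.trans hk, h⟩

theorem mul_gen_mem_of_cosetRep {j k i : ℕ} {y : B} (hy : y ∈ cosetSpan R b m j)
    (h : ∀ j' ≤ j, cosetRep b m j' * b i ∈ cosetSpan R b m k) : y * b i ∈ cosetSpan R b m k := by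
  induction hy using Submodule.span_induction with
  | mem y hy =>
    obtain ⟨z, hz, j', hj, rfl⟩ := hy
    rw [mul_assoc]
    exact mul_mem_cosetSpan hz (h j' hj)
  | zero => simp
  | add y z _ _ hy hz => rw [add_mul]; exact add_mem hy hz
  | smul r y _ hy => rw [smul_mul_assoc]; exact Submodule.smul_mem _ _ hy

theorem mul_gen_mem_succ {j i : ℕ} {y : B} (hi : i ≤ m)
    (H : ∀ j' ≤ j, ∀ i ≤ m, i ≠ letter m j' → cosetRep b m j' * b i ∈ cosetSpan R b m j')
    (hy : y ∈ cosetSpan R b m j) : y * b i ∈ cosetSpan R b m (j + 1) := by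
  refine mul_gen_mem_of_cosetRep hy fun j' hj' => ?_
  by_cases h : i = letter m j'
  · subst h
    exact cosetRep_mem_cosetSpan (k := j' + 1) (by omega)
  · exact cosetSpan_mono (by omega) (H j' hj' i hi h)

/-- A deformed version of Deodhar's lemma: only the next letter can lengthen a coset representative.
In the Coxeter group the other generators shorten it or pass through to the parabolic side; here the
corrections stay within the same length bound. -/
theorem cosetRep_mul_gen_mem (hsq : ∀ i ≤ m, b i * b i = 1)
    (hcomm : ∀ i j, i + 1 < j → j ≤ m → b i * b j = b j * b i)
    (hfour : 1 ≤ m → b 0 * b 1 * b 0 * b 1 = b 1 * b 0 * b 1 * b 0)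
    (hthree : ∀ i, i ≠ 0 → i + 1 ≤ m →
      b i * b (i + 1) * b i = b (i + 1) * b i * b (i + 1) + c • (b (i + 1) - b i))
    (j : ℕ) (hj : j ≤ 2 * m + 1) (i : ℕ) (hi : i ≤ m) (hij : i ≠ letter m j) :
    cosetRep b m j * b i ∈ cosetSpan R b m j := by
  induction j using Nat.strong_induction_on generalizing i with
  | _ j ih =>
  -- Below length `j`, multiplication by any generator raises the length bound by at most one.
  have step : ∀ k < j, ∀ i ≤ m, ∀ y ∈ cosetSpan R b m k, y * b i ∈ cosetSpan R b m (k + 1) :=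
    fun k hk i hi y hy => mul_gen_mem_succ hi
      (fun j' hj' i hi h => ih j' (by omega) (by omega) i hi h) hy
  obtain _ | k := j
  · refine Submodule.subset_span ⟨b i, Algebra.subset_adjoin ⟨i, ?_, rfl⟩, 0, le_rfl, by
      simp [cosetRep]⟩
    simp only [letter, Set.mem_Iio] at *
    omega
  have hl : letter m k ≤ m := by simp only [letter]; omega
  have hmem : ∀ i ≤ m, i ≠ letter m k → cosetRep b m k * b i ∈ cosetSpan R b m k :=
    ih k (by omega) (by omega)
  by_cases h1 : i = letter m k
  · rw [cosetRep, ← h1, mul_assoc, hsq i hi, mul_one]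
    exact cosetRep_mem_cosetSpan (by omega)
  by_cases h2 : i + 1 < letter m k ∨ letter m k + 1 < i
  · have hc : b (letter m k) * b i = b i * b (letter m k) := by
      rcases h2 with h2 | h2
      · exact (hcomm _ _ h2 hl).symm
      · exact hcomm _ _ h2 hi
    rw [cosetRep, mul_assoc, hc, ← mul_assoc]
    exact step k (by omega) _ hl _ (hmem i hi h1)
  -- From here on `i` is adjacent to the last letter. A word of length one ends in `m`, and the
  -- neighbour `m - 1` is its excluded next letter.
  obtain _ | k := k
  · simp only [letter] at *; omega
  -- Neighbours of the last letter are the letters before and after it in the full word; the latter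
  -- is excluded.
  have hik : i = letter m k := by simp only [letter] at *; omega
  have hmem' : ∀ i ≤ m, i ≠ letter m k → cosetRep b m k * b i ∈ cosetSpan R b m k :=
    ih k (by omega) (by omega)
  by_cases h0 : i = 0
  · have hl1 : letter m (k + 1) = 1 := by simp only [letter] at *; omega
    -- Here the word ends in `1 0 1`, and a further `0` calls for the braid relation of length four.
    obtain _ | k := k
    · simp only [letter] at *; omega
    have hk1 : letter m k = 1 := by simp only [letter] at *; omega
    have h := ih k (by omega) (by omega) 0 (by omega) (by omega)
    have e : cosetRep b m (k + 1 + 1 + 1) * b i =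
        cosetRep b m k * b 0 * b 1 * b 0 * b 1 := by
      have h4 := hfour (by omega)
      rw [cosetRep, cosetRep, cosetRep, hl1, ← hik, hk1, h0]
      simp only [mul_assoc] at h4 ⊢
      rw [h4]
    rw [e]
    exact step (k + 2) (by omega) _ (by omega) _ (step (k + 1) (by omega) _ (by omega) _
      (cosetSpan_mono (by omega) (step k (by omega) _ (by omega) _ h)))
  · have hl0 : letter m (k + 1) ≠ 0 := by simp only [letter] at *; omega
    -- The correction is antisymmetric in the two generators, so the same `c` serves whichever index
    -- is larger.
    have h3 : ∃ r : R, b i * b (letter m (k + 1)) * b i =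
        b (letter m (k + 1)) * b i * b (letter m (k + 1)) + r • (b (letter m (k + 1)) - b i) := by
      rcases (by omega : letter m (k + 1) = i + 1 ∨ i = letter m (k + 1) + 1) with h | h
      · exact ⟨c, h ▸ hthree i h0 (by omega)⟩
      · refine ⟨c, ?_⟩
        have := hthree (letter m (k + 1)) hl0 (by omega)
        rw [← h] at this
        rw [this, add_assoc, ← smul_add]
        simp
    obtain ⟨r, h3⟩ := h3
    have e : cosetRep b m (k + 1 + 1) * b i =
        cosetRep b m k * b (letter m (k + 1)) * b i * b (letter m (k + 1)) +
          r • (cosetRep b m k * b (letter m (k + 1)) - cosetRep b m (k + 1)) := by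
      rw [cosetRep, cosetRep, ← hik]
      simp only [mul_assoc] at h3 ⊢
      rw [h3, mul_add, mul_smul_comm, mul_sub]
    have h := hmem' (letter m (k + 1)) hl (by omega)
    rw [e]
    refine add_mem (step (k + 1) (by omega) _ hl _ (step k (by omega) _ hi _ h))
      (Submodule.smul_mem _ _ (sub_mem (cosetSpan_mono (by omega) h)
        (cosetRep_mem_cosetSpan (by omega))))

theorem parabolic_succ_le_cosetSpan (hsq : ∀ i ≤ m, b i * b i = 1)
    (hcomm : ∀ i j, i + 1 < j → j ≤ m → b i * b j = b j * b i)
    (hfour : 1 ≤ m → b 0 * b 1 * b 0 * b 1 = b 1 * b 0 * b 1 * b 0)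
    (hthree : ∀ i, i ≠ 0 → i + 1 ≤ m →
      b i * b (i + 1) * b i = b (i + 1) * b i * b (i + 1) + c • (b (i + 1) - b i)) :
    (parabolic R b (m + 1)).toSubmodule ≤ cosetSpan R b m (2 * m + 1) := by
  have P := cosetRep_mul_gen_mem (R := R) hsq hcomm hfour hthree
  have closed : ∀ i ≤ m, ∀ y ∈ cosetSpan R b m (2 * m + 1),
      y * b i ∈ cosetSpan R b m (2 * m + 1) := by
    refine fun i hi y hy => mul_gen_mem_of_cosetRep hy fun j hj => ?_
    by_cases h : i = letter m j
    -- The letter following the full word would be `m + 1`, which exceeds `i`.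
    · have : j ≠ 2 * m + 1 := by rintro rfl; simp only [letter] at h; omega
      rw [h]
      exact cosetRep_mem_cosetSpan (k := j + 1) (by omega)
    · exact cosetSpan_mono hj (P j hj i hi h)
  intro x hx
  suffices ∀ y ∈ cosetSpan R b m (2 * m + 1), y * x ∈ cosetSpan R b m (2 * m + 1) by
    simpa using this 1 (by simpa [cosetRep] using
      cosetRep_mem_cosetSpan (R := R) (b := b) (m := m) (Nat.zero_le (2 * m + 1)))
  refine Algebra.adjoin_induction (hx := hx) ?_ ?_ ?_ ?_
  · rintro _ ⟨i, hi, rfl⟩ y hy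
    exact closed i (Nat.lt_succ_iff.mp hi) y hy
  · intro r y hy
    rw [← Algebra.commutes, ← Algebra.smul_def]
    exact Submodule.smul_mem _ _ hy
  · intro u v _ _ hu hv y hy
    rw [mul_add]
    exact add_mem (hu y hy) (hv y hy)
  · intro u v _ _ hu hv y hy
    rw [← mul_assoc]
    exact hv _ (hu y hy)

/-- The index set of the monomials in normal form. -/
def NormalForm : ℕ → Type
  | 0 => Unit
  | m + 1 => NormalForm m × Fin (2 * m + 2)

instance NormalForm.instFintype : (m : ℕ) → Fintype (NormalForm m)
  | 0 => inferInstanceAs (Fintype Unit)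
  | m + 1 =>
    letI := NormalForm.instFintype m
    inferInstanceAs (Fintype (NormalForm m × Fin (2 * m + 2)))

/-- The monomial in normal form with the given index. -/
def monomial {M : Type*} [Monoid M] (b : ℕ → M) : (m : ℕ) → NormalForm m → M
  | 0, _ => 1
  | m + 1, x => monomial b m x.1 * cosetRep b m x.2

theorem card_normalForm (m : ℕ) : Fintype.card (NormalForm m) = 2 ^ m * m ! := by
  induction m with
  | zero => rfl
  | succ m ih =>
    have : Fintype.card (NormalForm (m + 1)) = Fintype.card (NormalForm m × Fin (2 * m + 2)) := rfl
    rw [this, Fintype.card_prod, ih, Fintype.card_fin, Nat.factorial_succ]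
    ring

theorem parabolic_le_span_monomial {n : ℕ} (hsq : ∀ i < n, b i * b i = 1)
    (hcomm : ∀ i j, i + 1 < j → j < n → b i * b j = b j * b i)
    (hfour : 1 < n → b 0 * b 1 * b 0 * b 1 = b 1 * b 0 * b 1 * b 0)
    (hthree : ∀ i, i ≠ 0 → i + 1 < n →
      b i * b (i + 1) * b i = b (i + 1) * b i * b (i + 1) + c • (b (i + 1) - b i))
    (m : ℕ) (hm : m ≤ n) :
    (parabolic R b m).toSubmodule ≤ Submodule.span R (Set.range (monomial b m)) := by
  induction m with
  | zero =>
    intro x hx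
    have hx' : x ∈ (⊥ : Subalgebra R B) := by
      have h0 : parabolic R b 0 = ⊥ := by
        rw [parabolic, show b '' Set.Iio 0 = ∅ by simp, Algebra.adjoin_empty]
      exact h0 ▸ hx
    obtain ⟨r, rfl⟩ := Algebra.mem_bot.mp hx'
    rw [Algebra.algebraMap_eq_smul_one]
    exact Submodule.smul_mem _ _ (Submodule.subset_span ⟨(() : Unit), rfl⟩)
  | succ m ih =>
    refine (parabolic_succ_le_cosetSpan (c := c) (fun i hi => hsq i (by omega))
      (fun i j hij hj => hcomm i j hij (by omega)) (fun h => hfour (by omega))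
      (fun i h0 hi => hthree i h0 (by omega))).trans (Submodule.span_le.mpr ?_)
    rintro _ ⟨x, hx, k, hk, rfl⟩
    have hx' := ih (by omega) hx
    show x * _ ∈ Submodule.span R _
    clear hx
    induction hx' using Submodule.span_induction with
    | mem y hy =>
      obtain ⟨z, rfl⟩ := hy
      exact Submodule.subset_span ⟨((z, ⟨k, by omega⟩) : NormalForm m × Fin (2 * m + 2)), rfl⟩
    | zero => simp
    | add y z _ _ hy hz => rw [add_mul]; exact add_mem hy hz
    | smul r y _ hy => rw [smul_mul_assoc]; exact Submodule.smul_mem _ _ hy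

end Spanning

/-! ### Counting normal forms by bidegree -/

/-- The bidegree of the generator `b_i`: the eigenvalues of `♯` and `♭`. -/
def genDegree (i : ℕ) : ℤˣ × ℤˣ := if i = 0 then (-1, 1) else (1, -1)

/-- Equidistribution survives multiplication by any independent factor: once `y` is fixed, the
condition selects the fibre of `f` over `g * (h y)⁻¹`. -/
theorem card_filter_degree_mul {α β G : Type*} [Fintype α] [Fintype β] [Group G] [DecidableEq G]
    (f : α → G) (h : β → G) {k : ℕ} (hf : ∀ g, Fintype.card {x // f x = g} = k) (g : G) :
    Fintype.card {x : α × β // f x.1 * h x.2 = g} = k * Fintype.card β := by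
  classical
  let e : {x : α × β // f x.1 * h x.2 = g} ≃ Σ y : β, {x : α // f x = g * (h y)⁻¹} :=
    { toFun := fun x => ⟨x.1.2, x.1.1, eq_mul_inv_of_mul_eq x.2⟩
      invFun := fun x => ⟨(x.2.1, x.1), by rw [x.2.2, inv_mul_cancel_right]⟩
      left_inv := fun _ => rfl
      right_inv := fun _ => rfl }
  rw [Fintype.card_congr e, Fintype.card_sigma]
  simp [hf, mul_comm]

/-- The induction starts at two generators, the first case in which all four bidegrees occur: each
appears twice among eight normal forms. -/
theorem card_degree_eq (m : ℕ) (g : ℤˣ × ℤˣ) :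
    Fintype.card {x : NormalForm (m + 2) // monomial genDegree (m + 2) x = g} =
      2 ^ m * (m + 2)! := by
  induction m generalizing g with
  | zero =>
    revert g
    decide
  | succ m ih =>
    have := card_filter_degree_mul (monomial genDegree (m + 2))
      (fun j : Fin (2 * (m + 2) + 2) => cosetRep genDegree (m + 2) j) ih g
    rw [Fintype.card_fin] at this
    refine Eq.trans ?_ (this.trans ?_)
    · exact Fintype.card_congr (Equiv.refl _)
    · rw [Nat.factorial_succ (m + 2)]; ring

/-! ### The regular representation on signed permutations -/

/-- Signed permutations. -/
abbrev SignedPerm (n : ℕ) : Type := Equiv.Perm (Fin n) × (Fin n → ℤˣ)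

/-- The values of a signed permutation, in `{±1, …, ±n}`. -/
def val (w : SignedPerm n) (k : Fin n) : ℤ := w.2 k * ((w.1 k : ℕ) + 1)

/-- The position preceding `i`. -/
def prev (i : Fin n) : Fin n := ⟨i - 1, by omega⟩

/-- Right multiplication of a signed permutation by a simple reflection. -/
def move (i : Fin n) (w : SignedPerm n) : SignedPerm n :=
  if (i : ℕ) = 0 then (w.1, Function.update w.2 i (-w.2 i))
  else (w.1 * Equiv.swap (prev i) i, w.2 ∘ Equiv.swap (prev i) i)

theorem natAbs_val (w : SignedPerm n) (k : Fin n) : (val w k).natAbs = (w.1 k : ℕ) + 1 := by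
  rw [val, Int.natAbs_mul, Int.units_natAbs, one_mul]; omega

theorem val_ne (w : SignedPerm n) {j k : Fin n} (h : j ≠ k) :
    val w j ≠ val w k ∧ val w j ≠ -val w k := by
  have : (val w j).natAbs ≠ (val w k).natAbs := by
    rw [natAbs_val, natAbs_val]
    exact fun h' => h (w.1.injective (Fin.ext (by omega)))
  omega

theorem val_injective : Function.Injective (val : SignedPerm n → Fin n → ℤ) := by
  intro w w' h
  have h1 : w.1 = w'.1 := by
    ext k
    have := congrArg Int.natAbs (congrFun h k)
    rw [natAbs_val, natAbs_val] at this
    omega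
  refine Prod.ext h1 (funext fun k => Units.ext ?_)
  have := congrFun h k
  rw [val, val, h1] at this
  exact mul_right_cancel₀ (by omega) this

theorem val_move_zero {i : Fin n} (hi : (i : ℕ) = 0) (w : SignedPerm n) (k : Fin n) :
    val (move i w) k = if k = i then -val w k else val w k := by
  rw [move, if_pos hi]
  by_cases h : k = i
  · subst h; simp [val]
  · simp [val, h]

theorem val_move {i : Fin n} (hi : (i : ℕ) ≠ 0) (w : SignedPerm n) (k : Fin n) :
    val (move i w) k = val w (Equiv.swap (prev i) i k) := by
  rw [move, if_neg hi]; rfl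

theorem move_move (i : Fin n) (w : SignedPerm n) : move i (move i w) = w := by
  apply val_injective
  ext k
  by_cases hi : (i : ℕ) = 0
  · simp only [val_move_zero hi]
    split_ifs <;> simp
  · simp [val_move hi]

theorem move_comm {i j : Fin n} (hij : (i : ℕ) + 1 < j) (w : SignedPerm n) :
    move i (move j w) = move j (move i w) := by
  apply val_injective
  ext k
  have hj : (j : ℕ) ≠ 0 := by omega
  by_cases hi : (i : ℕ) = 0
  · simp only [val_move_zero hi, val_move hj]
    have : Equiv.swap (prev j) j k = i ↔ k = i := by
      simp only [Equiv.swap_apply_def, prev, Fin.ext_iff]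
      split_ifs <;> simp_all <;> omega
    simp [this]
  · have h : Equiv.swap (prev j) j * Equiv.swap (prev i) i =
        Equiv.swap (prev i) i * Equiv.swap (prev j) j := by
      refine (Equiv.Perm.disjoint_swap_swap ?_).commute.eq
      simp [prev, Fin.ext_iff]
      omega
    simp only [val_move hi, val_move hj]
    exact congrArg (val w) (DFunLike.congr_fun h k)

theorem move_braid_three {i j : Fin n} (hi : (i : ℕ) ≠ 0) (hj : (j : ℕ) = i + 1)
    (w : SignedPerm n) : move i (move j (move i w)) = move j (move i (move j w)) := by
  have hj' : (j : ℕ) ≠ 0 := by omega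
  have hp : prev j = i := Fin.ext (by simp [prev, hj])
  have hij : j ≠ i := by simp [Fin.ext_iff]; omega
  have hip : prev i ≠ i := by simp [prev, Fin.ext_iff]; omega
  have hjp : prev i ≠ j := by simp [prev, Fin.ext_iff]; omega
  have h : Equiv.swap (prev i) i * Equiv.swap i j * Equiv.swap (prev i) i =
      Equiv.swap i j * Equiv.swap (prev i) i * Equiv.swap i j := by
    rw [Equiv.swap_mul_swap_mul_swap hip hjp, Equiv.swap_comm (prev i) i, Equiv.swap_comm i j,
      Equiv.swap_mul_swap_mul_swap hij hjp.symm, Equiv.swap_comm]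
  apply val_injective
  ext k
  simp only [val_move hi, val_move hj', hp]
  exact congrArg (val w) (DFunLike.congr_fun h k)

theorem move_braid_four {i j : Fin n} (hi : (i : ℕ) = 0) (hj : (j : ℕ) = 1)
    (w : SignedPerm n) :
    move i (move j (move i (move j w))) = move j (move i (move j (move i w))) := by
  apply val_injective
  ext k
  have hj' : (j : ℕ) ≠ 0 := by omega
  have hp : prev j = i := Fin.ext (by simp [prev, hi, hj])
  have hij : i ≠ j := fun h => by simp [h, hj] at hi
  simp only [val_move_zero hi, val_move hj', hp]
  by_cases h1 : k = i
  · subst h1; simp [hij.symm]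
  by_cases h2 : k = j
  · subst h2; simp [hij.symm]
  · simp [h1, h2, Equiv.swap_apply_of_ne_of_ne]

/-- `i` is a descent of `w`. As `a_1` has parameter `1`, descents at the first generator do not
matter, and are disregarded. -/
def IsDescent (i : Fin n) (w : SignedPerm n) : Prop := (i : ℕ) ≠ 0 ∧ val w i < val w (prev i)

open Classical in
/-- The operator of right multiplication by `a_i`, on the standard basis. -/
def op {R : Type*} [CommRing R] (t : R) (i : Fin n) : Module.End R (SignedPerm n →₀ R) :=
  Finsupp.linearCombination R fun w =>
    if IsDescent i w then t • Finsupp.single (move i w) 1 + (t - 1) • Finsupp.single w 1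
    else Finsupp.single (move i w) 1

open Classical in
theorem op_single {R : Type*} [CommRing R] (t : R) (i : Fin n) (w : SignedPerm n) :
    op t i (Finsupp.single w 1) =
      if IsDescent i w then t • Finsupp.single (move i w) 1 + (t - 1) • Finsupp.single w 1
      else Finsupp.single (move i w) 1 := by
  simp [op, Finsupp.linearCombination_single]

theorem isDescent_move_self {i : Fin n} (hi : (i : ℕ) ≠ 0) (w : SignedPerm n) :
    IsDescent i (move i w) ↔ ¬ IsDescent i w := by
  have hp : i ≠ prev i := fun h => by have := congrArg Fin.val h; simp [prev] at this; omega
  have := (val_ne w hp).1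
  simp only [IsDescent, val_move hi, Equiv.swap_apply_left, Equiv.swap_apply_right]
  omega

theorem op_sq_zero {R : Type*} [CommRing R] (t : R) (i : Fin n) (hi : (i : ℕ) = 0) : op t i * op t i = 1 := by
  have hd : ∀ w : SignedPerm n, ¬ IsDescent i w := fun w h => h.1 hi
  ext w : 2
  simp [op_single, hd, move_move]

/-- `move i` exchanges descents and non-descents at `i`, so each pair `w`, `move i w` spans a stable
plane. -/
theorem op_sq {R : Type*} [CommRing R] (t : R) (i : Fin n) (hi : (i : ℕ) ≠ 0) :
    op t i * op t i = (t - 1) • op t i + algebraMap R (Module.End R (SignedPerm n →₀ R)) t := by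
  refine Finsupp.lhom_ext' fun w => LinearMap.ext_ring ?_
  simp only [LinearMap.comp_apply, Finsupp.lsingle_apply, Module.End.mul_apply, LinearMap.add_apply,
    LinearMap.smul_apply, Module.algebraMap_end_apply, op_single]
  by_cases h : IsDescent i w
  · simp only [h, if_true, map_add, map_smul, op_single, isDescent_move_self hi, not_true,
      if_false, move_move]
    module
  · simp only [h, if_false, op_single, isDescent_move_self hi, not_false_iff, if_true, move_move]
    module

set_option linter.unnecessarySeqFocus false in
theorem op_comm {R : Type*} [CommRing R] (t : R) (i j : Fin n) (hij : (i : ℕ) + 1 < (j : ℕ)) :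
    op t i * op t j = op t j * op t i := by
  refine Finsupp.lhom_ext' fun w => LinearMap.ext_ring ?_
  have hj : (j : ℕ) ≠ 0 := by omega
  have hi' : IsDescent i (move j w) ↔ IsDescent i w := by
    have h1 : Equiv.swap (prev j) j i = i := Equiv.swap_apply_of_ne_of_ne
      (by simp [prev, Fin.ext_iff]; omega) (by simp [Fin.ext_iff]; omega)
    have h2 : Equiv.swap (prev j) j (prev i) = prev i := Equiv.swap_apply_of_ne_of_ne
      (by simp [prev, Fin.ext_iff]; omega) (by simp [prev, Fin.ext_iff]; omega)
    simp only [IsDescent, val_move hj, h1, h2]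
  have hj' : IsDescent j (move i w) ↔ IsDescent j w := by
    have h1 : j ≠ i := by simp [Fin.ext_iff]; omega
    have h2 : prev j ≠ i := by simp [prev, Fin.ext_iff]; omega
    by_cases hi : (i : ℕ) = 0
    · simp only [IsDescent, val_move_zero hi, h1, h2, if_false]
    · have h3 : j ≠ prev i := by simp [prev, Fin.ext_iff]; omega
      have h4 : prev j ≠ prev i := by simp [prev, Fin.ext_iff]; omega
      simp only [IsDescent, val_move hi, Equiv.swap_apply_of_ne_of_ne h3 h1,
        Equiv.swap_apply_of_ne_of_ne h4 h2]
  simp only [LinearMap.comp_apply, Finsupp.lsingle_apply, Module.End.mul_apply, op_single]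
  by_cases h : IsDescent i w <;> by_cases h' : IsDescent j w <;>
    simp only [h, h', hi', hj', if_true, if_false, map_add, map_smul, op_single,
      move_comm hij] <;> module

set_option linter.unusedSimpArgs false in
-- Only the relative order of the three distinct values at `prev i`, `i`, `j` matters, leaving a
-- finite check.
theorem op_braid_three {R : Type*} [CommRing R] (t : R) (i j : Fin n) (hi : (i : ℕ) ≠ 0) (hj : (j : ℕ) = (i : ℕ) + 1) :
    op t i * op t j * op t i = op t j * op t i * op t j := by
  refine Finsupp.lhom_ext' fun w => LinearMap.ext_ring ?_
  have hj0 : (j : ℕ) ≠ 0 := by omega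
  have hp : prev j = i := Fin.ext (by simp [prev, hj])
  have hji : j ≠ i := by simp [Fin.ext_iff]; omega
  have hjp : j ≠ prev i := by simp [prev, Fin.ext_iff]; omega
  have hip : i ≠ prev i := by simp [prev, Fin.ext_iff]; omega
  have di (v : SignedPerm n) : IsDescent i v ↔ val v i < val v (prev i) := by
    simp [IsDescent, hi]
  have dj (v : SignedPerm n) : IsDescent j v ↔ val v j < val v i := by
    simp [IsDescent, hj0, hp]
  have e1 (v : SignedPerm n) : val (move i v) (prev i) = val v i := by simp [val_move hi]
  have e2 (v : SignedPerm n) : val (move i v) i = val v (prev i) := by simp [val_move hi]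
  have e3 (v : SignedPerm n) : val (move i v) j = val v j := by
    simp [val_move hi, Equiv.swap_apply_of_ne_of_ne hjp hji]
  have e4 (v : SignedPerm n) : val (move j v) (prev i) = val v (prev i) := by
    rw [val_move hj0, hp, Equiv.swap_apply_of_ne_of_ne hip.symm hjp.symm]
  have e5 (v : SignedPerm n) : val (move j v) i = val v j := by simp [val_move hj0, hp]
  have e6 (v : SignedPerm n) : val (move j v) j = val v i := by simp [val_move hj0, hp]
  have n1 : val w (prev i) < val w i ↔ ¬ val w i < val w (prev i) := by
    have := (val_ne w hip).1; omega
  have n2 : val w i < val w j ↔ ¬ val w j < val w i := by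
    have := (val_ne w hji).1; omega
  have n3 : val w (prev i) < val w j ↔ ¬ val w j < val w (prev i) := by
    have := (val_ne w hjp).1; omega
  simp only [LinearMap.comp_apply, Finsupp.lsingle_apply, Module.End.mul_apply, op_single]
  by_cases h1 : val w i < val w (prev i) <;> by_cases h2 : val w j < val w i <;>
    by_cases h3 : val w j < val w (prev i) <;> first
    | (exfalso; omega)
    | (simp only [di, dj, e1, e2, e3, e4, e5, e6, n1, n2, n3, h1, h2, h3, not_true, not_false_iff,
        if_true, if_false, map_add, map_smul, op_single, move_move, move_braid_three hi hj]
       try module)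

set_option linter.unusedSimpArgs false in
-- With `x`, `y` the values at `i`, `j`, descents depend only on whether `y < x` and `y < -x`. The
-- signs of `x` and `y` do not enter, because the first generator has no descents.
theorem op_braid_four {R : Type*} [CommRing R] (t : R) (i j : Fin n) (hi : (i : ℕ) = 0) (hj : (j : ℕ) = 1) :
    op t i * op t j * op t i * op t j = op t j * op t i * op t j * op t i := by
  refine Finsupp.lhom_ext' fun w => LinearMap.ext_ring ?_
  have hj0 : (j : ℕ) ≠ 0 := by omega
  have hp : prev j = i := Fin.ext (by simp [prev, hi, hj])
  have hji : j ≠ i := by simp [Fin.ext_iff]; omega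
  have di (v : SignedPerm n) : ¬ IsDescent i v := fun h => h.1 hi
  have dj (v : SignedPerm n) : IsDescent j v ↔ val v j < val v i := by
    simp [IsDescent, hj0, hp]
  have e1 (v : SignedPerm n) : val (move i v) i = -val v i := by simp [val_move_zero hi]
  have e2 (v : SignedPerm n) : val (move i v) j = val v j := by simp [val_move_zero hi, hji]
  have e3 (v : SignedPerm n) : val (move j v) i = val v j := by simp [val_move hj0, hp]
  have e4 (v : SignedPerm n) : val (move j v) j = val v i := by simp [val_move hj0, hp]
  have hne := val_ne w hji
  have n1 : val w i < val w j ↔ ¬ val w j < val w i := by omega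
  have n2 : -val w i < -val w j ↔ val w j < val w i := by omega
  have n3 : -val w j < -val w i ↔ ¬ val w j < val w i := by omega
  have n4 : val w i < -val w j ↔ val w j < -val w i := by omega
  have n5 : -val w j < val w i ↔ ¬ val w j < -val w i := by omega
  have n6 : -val w i < val w j ↔ ¬ val w j < -val w i := by omega
  simp only [LinearMap.comp_apply, Finsupp.lsingle_apply, Module.End.mul_apply, op_single]
  by_cases h1 : val w j < val w i <;> by_cases h2 : val w j < -val w i <;>
    (simp only [di, dj, e1, e2, e3, e4, n1, n2, n3, n4, n5, n6, h1, h2, neg_neg, not_true,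
        not_false_iff, if_true, if_false, map_add, map_smul, op_single, move_move,
        move_braid_four hi hj]
     try module)

/-- The regular representation of `H n`, as an action on the module spanned by signed
permutations. -/
def regularRep : H n →ₐ[R₃] Module.End R₃ (SignedPerm n →₀ R₃) :=
  lift (op q) (by
    intro x y hxy
    cases hxy with
    | sq_first i hi => simp [op_sq_zero q i hi]
    | sq_other i hi => simp only [map_mul, map_add, map_smul, FreeAlgebra.lift_ι_apply,
        AlgHom.commutes, op_sq q i hi]
    | braid_four i j hi hj => simp [op_braid_four q i j hi hj]
    | braid_three i j hi hj => simp [op_braid_three q i j hi hj]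
    | comm i j hij => simp [op_comm q i j hij])

theorem regularRep_a (i : Fin n) : regularRep (a i) = op q i := lift_a _ _ i

/-- Adjacent transpositions generate all permutations, and conjugating the sign change at `0` by a
transposition gives the sign change at any position. -/
theorem move_induction {n : ℕ} {C : Set (SignedPerm n)} (h1 : 1 ∈ C)
    (hC : ∀ i, ∀ w ∈ C, move i w ∈ C) (w : SignedPerm n) : w ∈ C := by
  obtain _ | n := n
  · rwa [Subsingleton.elim w 1]
  have hperm : ∀ (π : Equiv.Perm (Fin (n + 1))) (w : SignedPerm (n + 1)), w ∈ C →
      (w.1 * π, w.2 ∘ π) ∈ C := by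
    intro π
    have hπ : π ∈ Submonoid.closure
        (Set.range fun i : Fin n => Equiv.swap i.castSucc i.succ) := by
      rw [Equiv.Perm.mclosure_swap_castSucc_succ]; trivial
    induction hπ using Submonoid.closure_induction with
    | mem π h =>
      obtain ⟨i, rfl⟩ := h
      intro w hw
      have := hC i.succ w hw
      rwa [move, if_neg (by simp), show prev i.succ = i.castSucc from Fin.ext (by simp [prev])]
        at this
    | one => exact fun w hw => hw
    | mul π π' _ _ h h' =>
      intro w hw
      have := h' _ (h w hw)
      rwa [mul_assoc] at this
  have hflip : ∀ (k : Fin (n + 1)) (w : SignedPerm (n + 1)), w ∈ C →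
      (w.1, Function.update w.2 k (-w.2 k)) ∈ C := by
    intro k w hw
    have h := hperm (Equiv.swap 0 k) _ (hC 0 _ (hperm (Equiv.swap 0 k) w hw))
    rw [move, if_pos (by simp)] at h
    convert h using 1
    refine Prod.ext ?_ (funext fun j => ?_)
    · simp [mul_assoc]
    · by_cases hj : j = k
      · subst hj; simp
      · have : Equiv.swap 0 k j ≠ 0 := fun h => hj (by
          have := congrArg (Equiv.swap 0 k) h
          simpa using this)
        simp [hj, this]
  have hsign : ∀ (s : Finset (Fin (n + 1))) (σ : Equiv.Perm (Fin (n + 1))),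
      (σ, fun k => if k ∈ s then (-1 : ℤˣ) else 1) ∈ C := by
    intro s σ
    induction s using Finset.induction_on with
    | empty => exact hperm σ 1 h1
    | insert k s hk ih =>
      convert hflip k _ ih using 2
      funext j
      by_cases hj : j = k
      · subst hj; simp [hk]
      · simp [hj]
  have hw : w = (w.1, fun k => if k ∈ ({k | w.2 k = -1} : Finset (Fin (n + 1))) then (-1 : ℤˣ)
      else 1) := by
    refine Prod.ext rfl (funext fun k => ?_)
    rcases Int.units_eq_one_or (w.2 k) with h | h <;> simp [h]
  rw [hw]
  exact hsign _ _

/-- The image contains the identity basis vector and is stable under every `op q i`, so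
`move_induction` reaches all basis vectors. -/
theorem regularRep_one_surjective :
    Function.Surjective fun h : H n => regularRep h (Finsupp.single 1 1) := by
  let f : H n →ₗ[R₃] (SignedPerm n →₀ R₃) :=
    (LinearMap.applyₗ (Finsupp.single 1 1)).comp regularRep.toLinearMap
  have hmul : ∀ (i : Fin n) (h : H n), f (a i * h) = op q i (f h) := fun i h => by
    simp [f, regularRep_a]
  suffices LinearMap.range f = ⊤ from LinearMap.range_eq_top.mp this
  have hsingle : ∀ w : SignedPerm n, (Finsupp.single w 1 : SignedPerm n →₀ R₃) ∈
      LinearMap.range f := by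
    refine move_induction (C := {w | Finsupp.single w 1 ∈ LinearMap.range f})
      ⟨1, by simp [f]⟩ fun i w hw => ?_
    obtain ⟨h, hh⟩ := hw
    have key : op q i (Finsupp.single w 1) ∈ LinearMap.range f := ⟨a i * h, by rw [hmul, hh]⟩
    rw [op_single] at key
    split_ifs at key
    -- At a descent the new basis vector carries the coefficient `q`, which is a unit.
    · have := Submodule.sub_mem _ key (Submodule.smul_mem _ (q - 1) ⟨h, hh⟩)
      rw [add_sub_cancel_right] at this
      exact (Submodule.smul_mem_iff_of_isUnit _ isUnit_q).mp this
    · exact key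
  rw [eq_top_iff]
  intro x _
  induction x using Finsupp.induction_linear with
  | zero => exact zero_mem _
  | add x y hx hy => exact add_mem (hx trivial) (hy trivial)
  | single w r =>
    rw [← Finsupp.smul_single_one]
    exact Submodule.smul_mem _ _ (hsingle w)

theorem card_signedPerm (n : ℕ) : Fintype.card (SignedPerm n) = 2 ^ n * n ! := by
  simp [Fintype.card_perm, mul_comm]

/-! ### The basis of normal forms and its bidegrees -/

/-- The elements `b_i`, indexed by natural numbers. -/
def gen (n k : ℕ) : H n := if h : k < n then b ⟨k, h⟩ else 1

theorem gen_of_lt {k : ℕ} (h : k < n) : gen n k = b ⟨k, h⟩ := dif_pos h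

instance : Nontrivial R₃ :=
  (IsLocalization.isDomain_localization (powers_le_nonZeroDivisors_of_noZeroDivisors
    (mul_ne_zero (mul_ne_zero two_ne_zero Polynomial.X_ne_zero)
      (Polynomial.X_add_C_ne_zero (1 : ℤ))))).toNontrivial

theorem span_monomial_gen : Submodule.span R₃ (Set.range (monomial (gen n) n)) = ⊤ := by
  have h := parabolic_le_span_monomial (R := R₃) (b := gen n) (n := n)
    (c := ((q - 1) * Ring.inverse (q + 1)) ^ 2)
    (fun i hi => by rw [gen_of_lt hi, b_sq])
    (fun i j hij hj => by rw [gen_of_lt hj, gen_of_lt (by omega), b_comm _ _ hij])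
    (fun hn => by
      rw [gen_of_lt hn, gen_of_lt (by omega), b_braid_four _ _ rfl rfl])
    (fun i h0 hi => by
      rw [gen_of_lt hi, gen_of_lt (by omega), b_braid_three _ _ h0 rfl]) n le_rfl
  have htop : parabolic R₃ (gen n) n = ⊤ := by
    rw [eq_top_iff, ← adjoin_range_b]
    refine Algebra.adjoin_mono ?_
    rintro _ ⟨i, rfl⟩
    exact ⟨i, i.2, gen_of_lt i.2⟩
  rw [htop, Algebra.top_toSubmodule] at h
  exact top_le_iff.mp h

/-- The images span a free module whose rank equals the number of monomials, so already the images
are independent. -/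
theorem linearIndependent_monomial_gen : LinearIndependent R₃ (monomial (gen n) n) := by
  let f : H n →ₗ[R₃] (SignedPerm n →₀ R₃) :=
    (LinearMap.applyₗ (Finsupp.single 1 1)).comp regularRep.toLinearMap
  refine LinearIndependent.of_comp f ?_
  refine linearIndependent_of_top_le_span_of_card_eq_finrank ?_ ?_
  · rw [Set.range_comp, Submodule.span_image, span_monomial_gen, Submodule.map_top,
      LinearMap.range_eq_top.mpr (regularRep_one_surjective (n := n))]
  · rw [Module.finrank_finsupp_self, card_normalForm, card_signedPerm]

/-- The basis of `H n` formed by the monomials in normal form. -/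
def monomialBasis (n : ℕ) : Module.Basis (NormalForm n) R₃ (H n) :=
  Module.Basis.mk linearIndependent_monomial_gen span_monomial_gen.ge

theorem monomialBasis_apply (x : NormalForm n) : monomialBasis n x = monomial (gen n) n x :=
  Module.Basis.mk_apply _ _ x

/-- `x` is a product of elements `b_i`, of bidegree `g`. -/
def IsWord (x : H n) (g : ℤˣ × ℤˣ) : Prop :=
  ∃ l : List (Fin n), x = (l.map b).prod ∧ g = (l.map fun i : Fin n => genDegree i).prod

theorem isWord_one : IsWord (1 : H n) 1 := ⟨[], rfl, rfl⟩

theorem IsWord.mul {x y : H n} {g h : ℤˣ × ℤˣ} (hx : IsWord x g) (hy : IsWord y h) :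
    IsWord (x * y) (g * h) := by
  obtain ⟨l, rfl, rfl⟩ := hx
  obtain ⟨l', rfl, rfl⟩ := hy
  exact ⟨l ++ l', by simp, by simp⟩

theorem isWord_gen {k : ℕ} (hk : k < n) : IsWord (gen n k) (genDegree k) :=
  ⟨[⟨k, hk⟩], by simp [gen_of_lt hk], by simp⟩

theorem isWord_cosetRep {m : ℕ} (hm : m < n) (j : ℕ) (hj : j ≤ 2 * m + 1) :
    IsWord (cosetRep (gen n) m j) (cosetRep genDegree m j) := by
  induction j with
  | zero => exact isWord_one
  | succ j ih => exact (ih (by omega)).mul (isWord_gen (by simp only [letter]; omega))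

theorem isWord_monomial (m : ℕ) (hm : m ≤ n) (x : NormalForm m) :
    IsWord (monomial (gen n) m x) (monomial genDegree m x) := by
  induction m with
  | zero => exact isWord_one
  | succ m ih =>
    exact (ih (by omega) x.1).mul (isWord_cosetRep (by omega) _ (Nat.lt_succ_iff.mp x.2.2))

theorem IsWord.sharp_eq {x : H n} {g : ℤˣ × ℤˣ} (hx : IsWord x g) :
    sharp x = ((g.1 : ℤ) : R₃) • x := by
  obtain ⟨l, rfl, rfl⟩ := hx
  induction l with
  | nil => simp
  | cons i l ih =>
    simp only [List.map_cons, List.prod_cons, map_mul, ih, sharp_b, genDegree]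
    split_ifs <;> simp

theorem IsWord.flat_eq {x : H n} {g : ℤˣ × ℤˣ} (hx : IsWord x g) :
    flat x = ((g.2 : ℤ) : R₃) • x := by
  obtain ⟨l, rfl, rfl⟩ := hx
  induction l with
  | nil => simp
  | cons i l ih =>
    simp only [List.map_cons, List.prod_cons, map_mul, ih, flat_b, genDegree]
    split_ifs <;> simp

/-- As `f` is diagonal in this basis, each coordinate of a fixed element equals `ε x` times itself;
for `ε x = -1` its double vanishes, and `2` is a unit. -/
theorem eq_one_or_repr_eq_zero {f : H n →ₐ[R₃] H n} {ε : NormalForm n → ℤˣ}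
    (hf : ∀ x, f (monomialBasis n x) = ((ε x : ℤ) : R₃) • monomialBasis n x) {h : H n}
    (hh : f h = h) (x : NormalForm n) : ε x = 1 ∨ (monomialBasis n).repr h x = 0 := by
  have key : (monomialBasis n).coord x ∘ₗ f.toLinearMap =
      ((ε x : ℤ) : R₃) • (monomialBasis n).coord x := by
    refine (monomialBasis n).ext fun y => ?_
    simp only [LinearMap.comp_apply, AlgHom.toLinearMap_apply, hf, map_smul, LinearMap.smul_apply,
      Module.Basis.coord_apply, Module.Basis.repr_self]
    by_cases hxy : y = x
    · rw [hxy]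
    · simp [Finsupp.single_eq_of_ne' hxy]
  have := LinearMap.congr_fun key h
  simp only [LinearMap.comp_apply, AlgHom.toLinearMap_apply, hh, LinearMap.smul_apply,
    Module.Basis.coord_apply] at this
  refine (Int.units_eq_one_or (ε x)).imp_right fun hε => ?_
  rw [hε] at this
  simp only [Units.val_neg, Units.val_one, Int.cast_neg, Int.cast_one, neg_smul, one_smul]
    at this
  exact isUnit_two.mul_right_eq_zero.mp (by rw [two_mul]; exact eq_neg_iff_add_eq_zero.mp this)

/-- The span of the monomials in normal form of trivial bidegree. -/
def evenSpan (n : ℕ) : Submodule R₃ (H n) :=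
  Submodule.span R₃ (Set.range fun x : {x : NormalForm n // monomial genDegree n x = 1} =>
    monomialBasis n x)

theorem mem_evenSpan {h : H n} (hs : sharp h = h) (hf : flat h = h) : h ∈ evenSpan n := by
  have word := fun x => isWord_monomial n le_rfl x
  rw [← (monomialBasis n).sum_repr h]
  refine Submodule.sum_mem _ fun x _ => ?_
  have h1 := eq_one_or_repr_eq_zero (ε := fun x => (monomial genDegree n x).1)
    (fun x => by rw [monomialBasis_apply]; exact (word x).sharp_eq) hs x
  have h2 := eq_one_or_repr_eq_zero (ε := fun x => (monomial genDegree n x).2)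
    (fun x => by rw [monomialBasis_apply]; exact (word x).flat_eq) hf x
  rcases h1 with h1 | h1
  · rcases h2 with h2 | h2
    · exact Submodule.smul_mem _ _ (Submodule.subset_span ⟨⟨x, Prod.ext h1 h2⟩, rfl⟩)
    · simp [h2]
  · simp [h1]

/-! ### Identification of `dagger` with the span of trivial bidegree -/

theorem sharp_bBar (hn : 2 ≤ n) (i : Fin n) : sharp (bBar hn i) = bBar hn i := by
  by_cases hi : (i : ℕ) = 0 <;> simp [bBar, hi, sharp_b]

theorem flat_bBar (hn : 2 ≤ n) (i : Fin n) : flat (bBar hn i) = -bBar hn i := by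
  by_cases hi : (i : ℕ) = 0 <;> simp [bBar, hi, flat_b]

theorem dagger_le (hn : 2 ≤ n) : dagger hn ≤ fixed natural ⊓ fixed flat ⊓ fixed sharp := by
  refine Algebra.adjoin_le ?_
  rintro _ ⟨l, hl, rfl⟩
  have hs : ∀ l : List (Fin n), sharp (l.map (bBar hn)).prod = (l.map (bBar hn)).prod := by
    intro l
    induction l with
    | nil => simp
    | cons i l ih => simp [ih, sharp_bBar]
  have hf : ∀ l : List (Fin n),
      flat (l.map (bBar hn)).prod = (-1) ^ l.length * (l.map (bBar hn)).prod := by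
    intro l
    induction l with
    | nil => simp
    | cons i l ih =>
      have := ((Commute.neg_one_left (bBar hn i)).pow_left l.length).eq
      simp [ih, flat_bBar, pow_succ, ← mul_assoc, this]
  have hf' : flat (l.map (bBar hn)).prod = (l.map (bBar hn)).prod := by
    rw [hf, hl.neg_one_pow, one_mul]
  refine ⟨⟨?_, hf'⟩, hs l⟩
  show natural _ = _
  rw [natural_eq_sharp_flat, hf', hs]
  rfl

/-- Conjugation by the involution `b 0` swaps the first two `bBar`s and fixes the rest, which
commute with `b 0`. -/
theorem first_mul_bBar (hn : 2 ≤ n) (i : Fin n) :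
    ∃ j, b ⟨0, by omega⟩ * bBar hn i = bBar hn j * b ⟨0, by omega⟩ := by
  by_cases h0 : (i : ℕ) = 0
  · obtain rfl : i = ⟨0, Nat.zero_lt_of_lt hn⟩ := Fin.ext h0
    refine ⟨⟨1, hn⟩, ?_⟩
    simp only [bBar, if_true, one_ne_zero, if_false]
    rw [← mul_assoc, ← mul_assoc, b_sq, one_mul]
  by_cases h1 : (i : ℕ) = 1
  · obtain rfl : i = ⟨1, hn⟩ := Fin.ext h1
    refine ⟨⟨0, by omega⟩, ?_⟩
    simp only [bBar, if_true, one_ne_zero, if_false]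
    rw [mul_assoc (b _ * b _) (b _) (b _), b_sq, mul_one]
  · refine ⟨i, ?_⟩
    simp only [bBar, h0, if_false]
    exact b_comm _ _ (by simp; omega)

theorem first_mul_prod_bBar (hn : 2 ≤ n) (l : List (Fin n)) :
    ∃ l' : List (Fin n), l'.length = l.length ∧
      b ⟨0, by omega⟩ * (l.map (bBar hn)).prod =
        (l'.map (bBar hn)).prod * b ⟨0, by omega⟩ := by
  induction l with
  | nil => exact ⟨[], rfl, by simp⟩
  | cons i l ih =>
    obtain ⟨l', hl', h⟩ := ih
    obtain ⟨j, hj⟩ := first_mul_bBar hn i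
    refine ⟨j :: l', by simp [hl'], ?_⟩
    rw [List.map_cons, List.prod_cons, ← mul_assoc, hj, mul_assoc, h, List.map_cons,
      List.prod_cons]
    exact (mul_assoc _ _ _).symm

theorem IsWord.mem_dagger (hn : 2 ≤ n) {x : H n} (hx : IsWord x 1) : x ∈ dagger hn := by
  -- With every `b 0` moved to the right, `k` counts the letters `b 0`, and `l'` has one entry for
  -- each other letter. Trivial bidegree makes both numbers even.
  have key : ∀ l : List (Fin n), ∃ (l' : List (Fin n)) (k : ℕ),
      (l.map b).prod = (l'.map (bBar hn)).prod * b ⟨0, by omega⟩ ^ k ∧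
      (l.map fun i : Fin n => genDegree i).prod = ((-1) ^ k, (-1) ^ l'.length) := by
    intro l
    induction l with
    | nil => exact ⟨[], 0, by simp, rfl⟩
    | cons i l ih =>
      obtain ⟨l', k, h, hd⟩ := ih
      by_cases hi : (i : ℕ) = 0
      · obtain rfl : i = ⟨0, Nat.zero_lt_of_lt hn⟩ := Fin.ext hi
        obtain ⟨l'', hl, hb⟩ := first_mul_prod_bBar hn l'
        refine ⟨l'', k + 1, ?_, ?_⟩
        · rw [List.map_cons, List.prod_cons, h, ← mul_assoc, hb, mul_assoc, pow_succ']
        · rw [List.map_cons, List.prod_cons, hd, hl]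
          simp [genDegree, pow_succ']
      · refine ⟨i :: l', k, ?_, ?_⟩
        · rw [List.map_cons, List.prod_cons, h, List.map_cons, List.prod_cons, show bBar hn i = b i by simp [bBar, hi]]
          exact (mul_assoc _ _ _).symm
        · rw [List.map_cons, List.prod_cons, hd]
          simp [genDegree, pow_succ', hi]
  obtain ⟨l, rfl, hl⟩ := hx
  obtain ⟨l', k, h, hd⟩ := key l
  rw [← hl] at hd
  have hk : Even k := by
    by_contra hk
    have := congrArg Prod.fst hd
    rw [(Nat.not_even_iff_odd.mp hk).neg_one_pow] at this
    exact absurd (show (1 : ℤˣ) = -1 from this) (by decide)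
  have hl' : Even l'.length := by
    by_contra hk
    have := congrArg Prod.snd hd
    rw [(Nat.not_even_iff_odd.mp hk).neg_one_pow] at this
    exact absurd (show (1 : ℤˣ) = -1 from this) (by decide)
  obtain ⟨r, rfl⟩ := hk
  rw [h, pow_add, ← (Commute.refl _).mul_pow, b_sq, one_pow, mul_one]
  exact Algebra.subset_adjoin ⟨l', hl', rfl⟩

theorem evenSpan_le_dagger (hn : 2 ≤ n) : evenSpan n ≤ (dagger hn).toSubmodule := by
  refine Submodule.span_le.mpr ?_
  rintro _ ⟨⟨x, hx⟩, rfl⟩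
  show monomialBasis n x ∈ dagger hn
  rw [monomialBasis_apply]
  exact IsWord.mem_dagger hn (hx ▸ isWord_monomial n le_rfl x)

theorem fixed_le_evenSpan :
    (fixed (natural (n := n)) ⊓ fixed flat ⊓ fixed sharp).toSubmodule ≤ evenSpan n :=
  fun _ hx => mem_evenSpan hx.2 hx.1.2

theorem dagger_toSubmodule (hn : 2 ≤ n) : (dagger hn).toSubmodule = evenSpan n :=
  le_antisymm (fun _ hx => fixed_le_evenSpan (dagger_le hn hx)) (evenSpan_le_dagger hn)

/-- The basis of `dagger hn` formed by the monomials of trivial bidegree. -/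
def daggerBasis (hn : 2 ≤ n) :
    Module.Basis {x : NormalForm n // monomial genDegree n x = 1} R₃ (dagger hn) :=
  (Module.Basis.span ((monomialBasis n).linearIndependent.comp _ Subtype.val_injective)).map
    (LinearEquiv.ofEq _ _ (dagger_toSubmodule hn).symm)

end
end HeckeTypeB

theorem proposition5p3 (n : ℕ) (hn : 2 ≤ n) :
    HeckeTypeB.dagger hn =
        HeckeTypeB.fixed HeckeTypeB.natural ⊓ HeckeTypeB.fixed HeckeTypeB.flat ⊓
          HeckeTypeB.fixed HeckeTypeB.sharp ∧
      Module.Free HeckeTypeB.R₃ (HeckeTypeB.dagger hn) ∧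
      Module.Finite HeckeTypeB.R₃ (HeckeTypeB.dagger hn) ∧
      Module.finrank HeckeTypeB.R₃ (HeckeTypeB.dagger hn) = 2 ^ (n - 2) * n ! := by
  refine ⟨le_antisymm (HeckeTypeB.dagger_le hn) fun x hx =>
      HeckeTypeB.evenSpan_le_dagger hn (HeckeTypeB.fixed_le_evenSpan hx),
    Module.Free.of_basis (HeckeTypeB.daggerBasis hn),
    Module.Finite.of_basis (HeckeTypeB.daggerBasis hn), ?_⟩
  rw [Module.finrank_eq_card_basis (HeckeTypeB.daggerBasis hn)]
  -- Writing `n = m + 2` removes the truncated subtraction in the exponent.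
  obtain ⟨m, rfl⟩ := Nat.exists_eq_add_of_le' hn
  exact HeckeTypeB.card_degree_eq m 1
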